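/- Let $(M,d)$ be a separable metric space in which every closed bounded set is compact, endowed with its Borel $\sigma$-algebra, and let $(I,\mathscr I,\nu)$ be a probability space. A continuous map $f\colon M\to M$ is called a \emph{paracontraction} if $d(f(y),x)<d(y,x)$ for every fixed point $x$ of $f$ and every $y\in M$ that is not a fixed point of $f$. Let $f_i\colon M\to M$, $i\in I$, be paracontractions such that $i\mapsto f_i(x)$ is measurable for every $x\in M$ (since the $f_i$ are continuous, this is the same as joint measurability of $(i,x)\mapsto f_i(x)$), and put $$C=\{x\in M\colon f_i(x)=x\ \text{for } \nu\text{-almost every } i\in I\}.$$ Let $(\xi_n)_{n\ge 0}$ be an ergodic stationary sequence of $I$-valued random variables on a probability space $(\Omega,\mathscr F,\mathbb P)$, each with distribution $\nu$; that is, the law of $(\xi_0,\xi_1,\dots)$ on $I^{\mathbb N}$ with the product $\sigma$-algebra is invariant and ergodic for the shift $(\omega_n)_n\mapsto(\omega_{n+1})_n$. Theorem. Assume that $C$ is non-empty. Then, for every $x_0\in M$, the sequence $(X_n)$ defined by $X_0=x_0$ and $X_{n+1}=f_{\xi_n}(X_n)$ for $n\ge 0$ converges $\mathbb P$-almost surely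 to a random variable $X\colon\Omega\to M$ taking values in $C$. -/

import Mathlib

open Set Filter Topology MeasureTheory ProbabilityTheory

/-- A continuous self-map `f` of a metric space is a paracontraction if it strictly decreases the
distance from every non-fixed point `y` to every fixed point `x`. -/
structure IsParacontraction {M : Type*} [MetricSpace M] (f : M → M) : Prop where
  continuous : Continuous f
  dist_lt : ∀ x y : M, f x = x → f y ≠ y → dist (f y) x < dist y x

/-- The solution set of the stochastic feasibility problem: the points that are fixed by
`f i` for `ν`-almost every `i`. -/
def commonFixedPoints {I M : Type*} [MeasurableSpace I] (ν : Measure I) (f : I → M → M) : Set M :=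
  {x | ∀ᵐ i ∂ν, f i x = x}

/-- The left shift on the space of sequences in `I`. -/
def seqShift {I : Type*} (s : ℕ → I) : ℕ → I := fun n => s (n + 1)

/-- `ξ` is an ergodic stationary sequence of `I`-valued random variables on `(Ω, P)`: each `ξ n` is
measurable, and the law of `(ξ 0, ξ 1, …)` on the product space `ℕ → I` (with the product
σ-algebra) is invariant (stationarity) and ergodic for the left shift. Mathlib's `Ergodic`
comprises both the invariance and the zero-one law for invariant measurable sets. -/
structure IsErgodicStationary {Ω I : Type*} [MeasurableSpace Ω] [MeasurableSpace I]
    (ξ : ℕ → Ω → I) (P : Measure Ω) : Prop where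
  measurable : ∀ n, Measurable (ξ n)
  ergodic : Ergodic seqShift (P.map (fun ω n => ξ n ω))

/-- The random iteration `X₀ = x₀`, `X_{n+1} = f_{ξ_n}(X_n)`. -/
def randomIteration {Ω I M : Type*} (f : I → M → M) (ξ : ℕ → Ω → I) (x₀ : M) : ℕ → Ω → M
  | 0 => fun _ => x₀
  | n + 1 => fun ω => f (ξ n ω) (randomIteration f ξ x₀ n ω)

/-!
Fix `z ∈ C`. Along the orbit the distance to `z` never increases, hence it converges, so the tails
of the driving sequence come arbitrarily close to admitting a starting point whose distance to `z`
does not drop at all; for paracontractions, such a point is fixed by every map of the sequence.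
If the orbit eventually stayed in a compact set `V` disjoint from `C`, then by compactness and
Poincaré recurrence the original sequence of maps would itself have a common fixed point in `V`.
By ergodicity, having a common fixed point in a given compact set has probability zero or one.
Shrinking the set to a point `x` shows that `x ∈ C` as soon as all these probabilities are one, so
a common fixed point in `V` almost surely does not exist. Thus the orbit comes arbitrarily close to
`C`, and as its distance to each point of `C` is nonincreasing, it converges to a point of `C`.
-/

section General

theorem measurableSet_setOf_exists_mem_of_isOpen {α X : Type*} [MeasurableSpace α]
    [TopologicalSpace X] [SecondCountableTopology X] {p : α → X → Prop}
    (hp_open : ∀ a, IsOpen {x | p a x}) (hp_meas : ∀ x, MeasurableSet {a | p a x}) (V : Set X) :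
    MeasurableSet {a | ∃ x ∈ V, p a x} := by
  obtain ⟨t, ht_countable, ht_dense⟩ := TopologicalSpace.exists_countable_dense V
  have hV : {a | ∃ x ∈ V, p a x} = ⋃ x ∈ t, {a | p a x} := by
    ext a
    simp only [mem_iUnion, exists_prop, mem_ofPred_eq]
    constructor
    · rintro ⟨x, hx, hax⟩
      obtain ⟨y, hay, hyt⟩ := ht_dense.exists_mem_open
        ((hp_open a).preimage continuous_subtype_val) ⟨⟨x, hx⟩, hax⟩
      exact ⟨y, hay, hyt⟩
    · rintro ⟨x, -, hax⟩
      exact ⟨x, x.2, hax⟩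
  rw [hV]
  exact .biUnion ht_countable fun x _ => hp_meas x

theorem exists_mem_forall_nonpos_of_isCompact {X : Type*} [TopologicalSpace X]
    [FirstCountableTopology X] {g : ℕ → X → ℝ} (hg : ∀ j, Continuous (g j)) {ε : ℕ → ℝ}
    (hε : Tendsto ε atTop (𝓝 0)) {V : Set X} (hV : IsCompact V)
    (h : ∀ m, ∃ x ∈ V, ∀ j ≤ m, g j x < ε m) : ∃ x ∈ V, ∀ j, g j x ≤ 0 := by
  choose u hu_mem hu using h
  obtain ⟨x, hx, φ, hφ, hux⟩ := hV.tendsto_subseq hu_mem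
  refine ⟨x, hx, fun j => ?_⟩
  refine le_of_tendsto_of_tendsto (((hg j).tendsto x).comp hux) (hε.comp hφ.tendsto_atTop) ?_
  filter_upwards [hφ.tendsto_atTop.eventually_ge_atTop j] with m hm
  exact (hu (φ m) j hm).le

theorem exists_mem_tendsto_of_antitone_dist {M : Type*} [PseudoMetricSpace M] [CompleteSpace M]
    {C : Set M} (hC : IsClosed C) {u : ℕ → M} (hu : ∀ c ∈ C, Antitone fun n => dist (u n) c)
    (hu_near : ∀ ε > 0, ∃ n, u n ∈ Metric.thickening ε C) :
    ∃ x ∈ C, Tendsto u atTop (𝓝 x) := by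
  have tail_near : ∀ ε > 0, ∃ c ∈ C, ∃ N, ∀ n ≥ N, dist (u n) c < ε := fun ε hε => by
    obtain ⟨N, hN⟩ := hu_near ε hε
    obtain ⟨c, hc, hNc⟩ := Metric.mem_thickening_iff.1 hN
    exact ⟨c, hc, N, fun n hn => (hu c hc hn).trans_lt hNc⟩
  have hcauchy : CauchySeq u := Metric.cauchySeq_iff.2 fun ε hε => by
    obtain ⟨c, -, N, hN⟩ := tail_near (ε / 2) (half_pos hε)
    exact ⟨N, fun m hm n hn => (dist_triangle_right _ _ c).trans_lt
      ((add_lt_add (hN m hm) (hN n hn)).trans_eq (add_halves ε))⟩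
  obtain ⟨x, hx⟩ := cauchySeq_tendsto_of_complete hcauchy
  refine ⟨x, hC.closure_subset (Metric.mem_closure_iff.2 fun ε hε => ?_), hx⟩
  obtain ⟨c, hc, N, hN⟩ := tail_near (ε / 2) (half_pos hε)
  refine ⟨c, hc, (le_of_tendsto (hx.dist tendsto_const_nhds) ?_).trans_lt (half_lt_self hε)⟩
  filter_upwards [eventually_ge_atTop N] with n hn
  exact (hN n hn).le

theorem exists_measurable_forall_mem_ae_tendsto {Ω M : Type*} [MeasurableSpace Ω] {P : Measure Ω}
    [TopologicalSpace M] [TopologicalSpace.PseudoMetrizableSpace M] [T2Space M]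
    [MeasurableSpace M] [BorelSpace M] {u : ℕ → Ω → M} (hu : ∀ n, AEMeasurable (u n) P)
    {C : Set M} (hC : C.Nonempty)
    (h : ∀ᵐ ω ∂P, ∃ x ∈ C, Tendsto (fun n => u n ω) atTop (𝓝 x)) :
    ∃ X : Ω → M, Measurable X ∧ (∀ ω, X ω ∈ C) ∧
      ∀ᵐ ω ∂P, Tendsto (fun n => u n ω) atTop (𝓝 (X ω)) := by
  obtain ⟨Y, hY, hY_lim⟩ := measurable_limit_of_tendsto_metrizable_ae hu
    (h.mono fun ω ⟨x, _, hx⟩ => ⟨x, hx⟩)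
  have hY_mem : ∀ᵐ ω ∂P, Y ω ∈ C := by
    filter_upwards [h, hY_lim] with ω ⟨x, hxC, hx⟩ hYω
    rwa [tendsto_nhds_unique hYω hx]
  obtain ⟨X, hX, hXC, hYX⟩ := hY.aemeasurable.exists_ae_eq_range_subset hY_mem hC
  refine ⟨X, hX, fun ω => hXC (mem_range_self ω), ?_⟩
  filter_upwards [hY_lim, hYX] with ω hω hYXω
  rwa [← hYXω]

theorem ae_forall_iterate {Ω : Type*} [MeasurableSpace Ω] {P : Measure Ω} {T : Ω → Ω}
    (hT : Measure.QuasiMeasurePreserving T P P) {p : Ω → Prop} (hp : ∀ᵐ ω ∂P, p ω) :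
    ∀ᵐ ω ∂P, ∀ k, p (T^[k] ω) :=
  ae_all_iff.2 fun k => (hT.iterate k).ae hp

end General

theorem IsParacontraction.dist_le {M : Type*} [MetricSpace M] {g : M → M}
    (hg : IsParacontraction g) {x : M} (hx : g x = x) (y : M) : dist (g y) x ≤ dist y x := by
  by_cases hy : g y = y
  · rw [hy]
  · exact (hg.dist_lt x y hx hy).le

/-- The cocycle over `T` generated by the random map `f`: the composition
`f (T^[n - 1] ω) ∘ ⋯ ∘ f (T ω) ∘ f ω`. With `T` the shift on sequences of indices, it is the
random iteration along a sequence, started at an arbitrary point. -/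
def cocycle {Ω M : Type*} (T : Ω → Ω) (f : Ω → M → M) : ℕ → Ω → M → M
  | 0, _ => id
  | n + 1, ω => f (T^[n] ω) ∘ cocycle T f n ω

section Cocycle

variable {Ω M : Type*} {T : Ω → Ω} {f : Ω → M → M}

theorem cocycle_succ_apply (n : ℕ) (ω : Ω) (x : M) :
    cocycle T f (n + 1) ω x = f (T^[n] ω) (cocycle T f n ω x) :=
  rfl

theorem cocycle_add_apply (m n : ℕ) (ω : Ω) (x : M) :
    cocycle T f (m + n) ω x = cocycle T f m (T^[n] ω) (cocycle T f n ω x) := by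
  induction m with
  | zero => rw [zero_add]; rfl
  | succ m ih =>
    rw [add_right_comm, cocycle_succ_apply, ih, Function.iterate_add_apply, cocycle_succ_apply]

theorem apply_iterate_eq_self_of_cocycle_eq_self {ω : Ω} {x : M}
    (h : ∀ n, cocycle T f n ω x = x) (k : ℕ) : f (T^[k] ω) x = x := by
  simpa only [cocycle_succ_apply, h k] using h (k + 1)

theorem continuous_cocycle [TopologicalSpace M] (hf : ∀ ω, Continuous (f ω)) (n : ℕ) (ω : Ω) :
    Continuous (cocycle T f n ω) := by
  induction n with
  | zero => exact continuous_id
  | succ n ih => exact (hf _).comp ih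

theorem measurable_cocycle [MeasurableSpace Ω] [TopologicalSpace M]
    [TopologicalSpace.MetrizableSpace M] [SecondCountableTopology M] [MeasurableSpace M]
    [BorelSpace M] (hT : Measurable T) (hf : ∀ ω, Continuous (f ω))
    (hf_meas : ∀ x, Measurable fun ω => f ω x) (n : ℕ) (x : M) :
    Measurable fun ω => cocycle T f n ω x := by
  have huncurry : Measurable (Function.uncurry fun x ω => f ω x) :=
    measurable_uncurry_of_continuous_of_measurable hf hf_meas
  induction n with
  | zero => exact measurable_const
  | succ n ih => exact huncurry.comp (ih.prodMk (hT.iterate n))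

variable [MetricSpace M]

theorem antitone_dist_cocycle (hf : ∀ ω, IsParacontraction (f ω)) {ω : Ω} {z : M}
    (hz : ∀ k, f (T^[k] ω) z = z) (x : M) : Antitone fun n => dist (cocycle T f n ω x) z :=
  antitone_nat_of_succ_le fun _ => (hf _).dist_le (hz _) _

theorem cocycle_eq_self_of_dist_le (hf : ∀ ω, IsParacontraction (f ω)) {ω : Ω} {z x : M}
    (hz : ∀ k, f (T^[k] ω) z = z) (hx : ∀ n, dist x z ≤ dist (cocycle T f n ω x) z) (n : ℕ) :
    cocycle T f n ω x = x := by
  induction n with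
  | zero => rfl
  | succ n ih =>
    have hdist := hx (n + 1)
    rw [cocycle_succ_apply, ih] at hdist ⊢
    exact of_not_not fun hne => ((hf _).dist_lt z x (hz n) hne).not_ge hdist

end Cocycle

/-- The event that the maps `f ω, f (T ω), f (T^[2] ω), …` have a common fixed point in `V`. -/
def fixingSet {Ω M : Type*} (T : Ω → Ω) (f : Ω → M → M) (V : Set M) : Set Ω :=
  {ω | ∃ x ∈ V, ∀ k, f (T^[k] ω) x = x}

/-- The event that the distance to `z` of some point of `V` drops by less than `1 / (m + 1)` during
the first `m` steps. For `z` fixed by all maps, this is an approximate form of the event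
`fixingSet T f V`. -/
def nearlyFixingSet {Ω M : Type*} [MetricSpace M] (T : Ω → Ω) (f : Ω → M → M) (z : M) (V : Set M)
    (m : ℕ) : Set Ω :=
  {ω | ∃ x ∈ V, ∀ j ≤ m, dist x z - dist (cocycle T f j ω x) z < 1 / ((m : ℝ) + 1)}

section FixingSet

variable {Ω M : Type*} {T : Ω → Ω} {f : Ω → M → M}

theorem fixingSet_mono {V W : Set M} (h : V ⊆ W) : fixingSet T f V ⊆ fixingSet T f W :=
  fun _ ⟨x, hxV, hx⟩ => ⟨x, h hxV, hx⟩

theorem fixingSet_union (V W : Set M) :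
    fixingSet T f (V ∪ W) = fixingSet T f V ∪ fixingSet T f W := by
  ext ω
  simp only [fixingSet, mem_union, mem_ofPred_eq, or_and_right, exists_or]

variable [MetricSpace M]

theorem mem_fixingSet_of_forall_mem_nearlyFixingSet (hf : ∀ ω, IsParacontraction (f ω)) {ω : Ω}
    {z : M} (hz : ∀ k, f (T^[k] ω) z = z) {V : Set M} (hV : IsCompact V)
    (h : ∀ m, ω ∈ nearlyFixingSet T f z V m) : ω ∈ fixingSet T f V := by
  have hcont : ∀ j, Continuous fun x => dist x z - dist (cocycle T f j ω x) z := fun j =>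
    (continuous_id.dist continuous_const).sub
      ((continuous_cocycle (fun ω => (hf ω).continuous) j ω).dist continuous_const)
  obtain ⟨x, hxV, hx⟩ := exists_mem_forall_nonpos_of_isCompact hcont
    tendsto_one_div_add_atTop_nhds_zero_nat hV h
  exact ⟨x, hxV, apply_iterate_eq_self_of_cocycle_eq_self
    (cocycle_eq_self_of_dist_le hf hz fun n => sub_nonpos.1 (hx n))⟩

theorem eventually_iterate_mem_nearlyFixingSet (hf : ∀ ω, IsParacontraction (f ω)) {ω : Ω} {z : M}
    (hz : ∀ k, f (T^[k] ω) z = z) {V : Set M} {x : M}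
    (hx : ∀ᶠ n in atTop, cocycle T f n ω x ∈ V) (m : ℕ) :
    ∀ᶠ n in atTop, T^[n] ω ∈ nearlyFixingSet T f z V m := by
  have hbdd : BddBelow (range fun n => dist (cocycle T f n ω x) z) :=
    ⟨0, forall_mem_range.2 fun _ => dist_nonneg⟩
  have hlim := tendsto_atTop_ciInf (antitone_dist_cocycle hf hz x) hbdd
  have hclose := hlim.eventually_lt_const
    (lt_add_of_pos_right _ (show (0 : ℝ) < 1 / ((m : ℝ) + 1) by positivity))
  filter_upwards [hx, hclose] with n hnV hn
  refine ⟨_, hnV, fun j _ => ?_⟩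
  rw [← cocycle_add_apply]
  linarith [ciInf_le hbdd (j + n)]

variable [MeasurableSpace Ω] {P : Measure Ω} [SecondCountableTopology M] [MeasurableSpace M]
  [BorelSpace M]

theorem measurableSet_nearlyFixingSet (hT : Measurable T) (hf : ∀ ω, Continuous (f ω))
    (hf_meas : ∀ x, Measurable fun ω => f ω x) (z : M) (V : Set M) (m : ℕ) :
    MeasurableSet (nearlyFixingSet T f z V m) := by
  refine measurableSet_setOf_exists_mem_of_isOpen (fun ω => ?_) (fun x => ?_) V
  · simp only [ofPred_forall]
    exact (finite_Iic m).isOpen_biInter fun j _ => isOpen_lt ((continuous_id.dist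
      continuous_const).sub ((continuous_cocycle hf j ω).dist continuous_const)) continuous_const
  · simp only [ofPred_forall]
    exact .iInter fun j => .iInter fun _ => measurableSet_lt (measurable_const.sub
      ((measurable_cocycle hT hf hf_meas j x).dist measurable_const)) measurable_const

theorem measurableSet_fixingSet (hT : Measurable T) (hf : ∀ ω, Continuous (f ω))
    (hf_meas : ∀ x, Measurable fun ω => f ω x) {V : Set M} (hV : IsCompact V) :
    MeasurableSet (fixingSet T f V) := by
  have hfix : fixingSet T f V =
      ⋂ m : ℕ, {ω | ∃ x ∈ V, ∀ j ≤ m, dist (f (T^[j] ω) x) x < 1 / ((m : ℝ) + 1)} := by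
    ext ω
    simp only [mem_iInter, mem_ofPred_eq]
    refine ⟨fun ⟨x, hxV, hx⟩ m => ⟨x, hxV, fun j _ => ?_⟩, fun h => ?_⟩
    · rw [hx j, dist_self]
      positivity
    · obtain ⟨x, hxV, hx⟩ := exists_mem_forall_nonpos_of_isCompact
        (fun j => (hf (T^[j] ω)).dist continuous_id) tendsto_one_div_add_atTop_nhds_zero_nat hV h
      exact ⟨x, hxV, fun k => dist_le_zero.1 (hx k)⟩
  rw [hfix]
  refine .iInter fun m => measurableSet_setOf_exists_mem_of_isOpen (fun ω => ?_) (fun x => ?_) V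
  · simp only [ofPred_forall]
    exact (finite_Iic m).isOpen_biInter fun j _ =>
      isOpen_lt ((hf _).dist continuous_id) continuous_const
  · simp only [ofPred_forall]
    exact .iInter fun j => .iInter fun _ => measurableSet_lt
      (((hf_meas x).comp (hT.iterate j)).dist measurable_const) measurable_const

theorem ae_mem_fixingSet_of_eventually_mem (hT : Conservative T P)
    (hf : ∀ ω, IsParacontraction (f ω)) (hf_meas : ∀ x, Measurable fun ω => f ω x)
    (hC : (commonFixedPoints P f).Nonempty) {V : Set M} (hV : IsCompact V) (x : M) :
    ∀ᵐ ω ∂P, (∀ᶠ n in atTop, cocycle T f n ω x ∈ V) → ω ∈ fixingSet T f V := by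
  obtain ⟨z, hz⟩ := hC
  have hrec : ∀ᵐ ω ∂P, ∀ m, ω ∉ nearlyFixingSet T f z V m →
      ∃ᶠ n in atTop, T^[n] ω ∉ nearlyFixingSet T f z V m := ae_all_iff.2 fun m =>
    hT.ae_mem_imp_frequently_image_mem (measurableSet_nearlyFixingSet hT.measurable
      (fun ω => (hf ω).continuous) hf_meas z V m).compl.nullMeasurableSet
  filter_upwards [hrec, ae_forall_iterate hT.toQuasiMeasurePreserving hz] with ω hω hzω hstay
  exact mem_fixingSet_of_forall_mem_nearlyFixingSet hf hzω hV fun m => of_not_not fun hm =>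
    hω m hm ((eventually_iterate_mem_nearlyFixingSet hf hzω hstay m).mono fun _ => not_not_intro)

theorem measure_fixingSet_eq_zero_or_ae_mem [IsFiniteMeasure P] (hT : Ergodic T P)
    (hf : ∀ ω, Continuous (f ω)) (hf_meas : ∀ x, Measurable fun ω => f ω x) {V : Set M}
    (hV : IsCompact V) : P (fixingSet T f V) = 0 ∨ ∀ᵐ ω ∂P, ω ∈ fixingSet T f V := by
  have hsub : fixingSet T f V ⊆ T ⁻¹' fixingSet T f V := fun ω ⟨x, hxV, hx⟩ =>
    ⟨x, hxV, fun k => hx (k + 1)⟩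
  exact (hT.ae_empty_or_univ_of_ae_le_preimage
    (measurableSet_fixingSet hT.measurable hf hf_meas hV).nullMeasurableSet
    hsub.eventuallyLE).imp ae_eq_empty.1 eventuallyEq_univ.1

end FixingSet

section CommonFixedPoints

theorem commonFixedPoints_comp {Ω I M : Type*} [MeasurableSpace Ω] [MeasurableSpace I]
    {P : Measure Ω} {ν : Measure I} [MeasurableSpace M] [MeasurableSingletonClass M] {g : Ω → I}
    (hg : MeasurePreserving g P ν) {f : I → M → M} (hf_meas : ∀ x, Measurable fun i => f i x) :
    commonFixedPoints P (fun ω => f (g ω)) = commonFixedPoints ν f := by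
  ext x
  rw [commonFixedPoints, commonFixedPoints, mem_ofPred_eq, mem_ofPred_eq, ← hg.map_eq]
  exact (ae_map_iff hg.aemeasurable (hf_meas x (measurableSet_singleton x))).symm

variable {Ω M : Type*} [MeasurableSpace Ω] {P : Measure Ω} {f : Ω → M → M}

theorem ae_forall_mem_commonFixedPoints [TopologicalSpace M] [T2Space M]
    [SecondCountableTopology M] (hf : ∀ ω, Continuous (f ω)) :
    ∀ᵐ ω ∂P, ∀ x ∈ commonFixedPoints P f, f ω x = x := by
  obtain ⟨t, ht_countable, ht_dense⟩ :=
    TopologicalSpace.exists_countable_dense (commonFixedPoints P f)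
  filter_upwards [(ae_ball_iff ht_countable).2 fun x _ => x.2] with ω hω x hx
  have hclosed : IsClosed {y : commonFixedPoints P f | f ω y = y} :=
    isClosed_eq ((hf ω).comp continuous_subtype_val) continuous_subtype_val
  exact hclosed.closure_subset_iff.2 hω (ht_dense ⟨x, hx⟩)

theorem isClosed_commonFixedPoints [TopologicalSpace M] [T2Space M]
    [SecondCountableTopology M] (hf : ∀ ω, Continuous (f ω)) :
    IsClosed (commonFixedPoints P f) := by
  refine isClosed_of_closure_subset fun x hx => ?_
  filter_upwards [ae_forall_mem_commonFixedPoints hf] with ω hω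
  exact (isClosed_eq (hf ω) continuous_id).closure_subset_iff.2 hω hx

theorem mem_commonFixedPoints_of_ae_mem_fixingSet [MetricSpace M] {T : Ω → Ω}
    (hf : ∀ ω, Continuous (f ω)) {x : M}
    (hx : ∀ ε > 0, ∀ᵐ ω ∂P, ω ∈ fixingSet T f (Metric.closedBall x ε)) :
    x ∈ commonFixedPoints P f := by
  have hballs : ∀ᵐ ω ∂P, ∀ n : ℕ, ω ∈ fixingSet T f (Metric.closedBall x (1 / ((n : ℝ) + 1))) :=
    ae_all_iff.2 fun n => hx _ (by positivity)
  filter_upwards [hballs] with ω hω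
  choose y hy_mem hy using hω
  have hyx : Tendsto y atTop (𝓝 x) := tendsto_iff_dist_tendsto_zero.2 <|
    squeeze_zero (fun _ => dist_nonneg) hy_mem tendsto_one_div_add_atTop_nhds_zero_nat
  exact (isClosed_eq (hf ω) continuous_id).mem_of_tendsto hyx (.of_forall fun n => hy n 0)

end CommonFixedPoints

section Ergodic

variable {Ω M : Type*} [MeasurableSpace Ω] {P : Measure Ω} [IsFiniteMeasure P] [MetricSpace M]
  [MeasurableSpace M] [BorelSpace M] {T : Ω → Ω} {f : Ω → M → M}

theorem measure_fixingSet_eq_zero [SecondCountableTopology M] (hT : Ergodic T P)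
    (hf : ∀ ω, Continuous (f ω)) (hf_meas : ∀ x, Measurable fun ω => f ω x) {V : Set M}
    (hV : IsCompact V) (hVC : Disjoint V (commonFixedPoints P f)) : P (fixingSet T f V) = 0 := by
  have hlocal : ∀ x ∈ V, ∃ W ∈ 𝓝[V] x, P (fixingSet T f W) = 0 := by
    intro x hxV
    by_contra! hpos
    refine hVC.notMem_of_mem_left hxV
      (mem_commonFixedPoints_of_ae_mem_fixingSet (T := T) hf fun ε hε => ?_)
    have hone : ∀ᵐ ω ∂P, ω ∈ fixingSet T f (V ∩ Metric.closedBall x ε) :=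
      (measure_fixingSet_eq_zero_or_ae_mem hT hf hf_meas
        (hV.inter_right Metric.isClosed_closedBall)).resolve_left
      (hpos _ (inter_mem_nhdsWithin V (Metric.closedBall_mem_nhds x hε)))
    exact hone.mono fun _ hω => fixingSet_mono inter_subset_right hω
  refine hV.induction_on (p := fun W => P (fixingSet T f W) = 0) (by simp [fixingSet])
    (fun _ _ hW => measure_mono_null (fixingSet_mono hW)) (fun _ _ hW hW' => ?_) hlocal
  rw [fixingSet_union]
  exact measure_union_null hW hW'

theorem ae_frequently_cocycle_notMem [SecondCountableTopology M] (hT : Ergodic T P)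
    (hf : ∀ ω, IsParacontraction (f ω)) (hf_meas : ∀ x, Measurable fun ω => f ω x)
    (hC : (commonFixedPoints P f).Nonempty) {V : Set M} (hV : IsCompact V)
    (hVC : Disjoint V (commonFixedPoints P f)) (x : M) :
    ∀ᵐ ω ∂P, ∃ᶠ n in atTop, cocycle T f n ω x ∉ V := by
  filter_upwards [ae_mem_fixingSet_of_eventually_mem hT.conservative hf hf_meas hC hV x,
    measure_eq_zero_iff_ae_notMem.1 (measure_fixingSet_eq_zero hT
      (fun ω => (hf ω).continuous) hf_meas hV hVC)] with ω hstay hω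
  exact not_eventually.1 (mt hstay hω)

theorem ae_exists_mem_thickening [ProperSpace M] (hT : Ergodic T P)
    (hf : ∀ ω, IsParacontraction (f ω)) (hf_meas : ∀ x, Measurable fun ω => f ω x)
    (hC : (commonFixedPoints P f).Nonempty) (x : M) :
    ∀ᵐ ω ∂P, ∀ ε > 0, ∃ n, cocycle T f n ω x ∈ Metric.thickening ε (commonFixedPoints P f) := by
  obtain ⟨z, hz⟩ := hC
  have hexit : ∀ᵐ ω ∂P, ∀ m : ℕ, ∃ᶠ n in atTop, cocycle T f n ω x ∉
      Metric.closedBall z (dist x z) \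
        Metric.thickening (1 / ((m : ℝ) + 1)) (commonFixedPoints P f) :=
    ae_all_iff.2 fun m => ae_frequently_cocycle_notMem hT hf hf_meas ⟨z, hz⟩
      ((isCompact_closedBall _ _).diff Metric.isOpen_thickening)
      (disjoint_sdiff_left.mono_right (Metric.self_subset_thickening (by positivity) _)) x
  filter_upwards [hexit, ae_forall_iterate hT.quasiMeasurePreserving hz] with ω hω hzω ε hε
  obtain ⟨m, hm⟩ := exists_nat_one_div_lt hε
  obtain ⟨n, hn⟩ := (hω m).exists
  have hball : cocycle T f n ω x ∈ Metric.closedBall z (dist x z) :=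
    antitone_dist_cocycle hf hzω x n.zero_le
  exact ⟨n, Metric.thickening_mono hm.le _ (of_not_not fun h => hn ⟨hball, h⟩)⟩

theorem exists_measurable_ae_tendsto_cocycle [ProperSpace M] (hT : Ergodic T P)
    (hf : ∀ ω, IsParacontraction (f ω)) (hf_meas : ∀ x, Measurable fun ω => f ω x)
    (hC : (commonFixedPoints P f).Nonempty) (x : M) :
    ∃ X : Ω → M, Measurable X ∧ (∀ ω, X ω ∈ commonFixedPoints P f) ∧
      ∀ᵐ ω ∂P, Tendsto (fun n => cocycle T f n ω x) atTop (𝓝 (X ω)) := by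
  have hf_cont : ∀ ω, Continuous (f ω) := fun ω => (hf ω).continuous
  refine exists_measurable_forall_mem_ae_tendsto
    (fun n => (measurable_cocycle hT.measurable hf_cont hf_meas n x).aemeasurable) hC ?_
  filter_upwards [ae_exists_mem_thickening hT hf hf_meas hC x, ae_forall_iterate
    hT.quasiMeasurePreserving (ae_forall_mem_commonFixedPoints hf_cont)] with ω hnear hfix
  exact exists_mem_tendsto_of_antitone_dist (isClosed_commonFixedPoints hf_cont)
    (fun c hc => antitone_dist_cocycle hf (fun k => hfix k c hc) x) hnear

end Ergodic

section Shift

variable {I : Type*}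

theorem iterate_seqShift_apply (s : ℕ → I) (n k : ℕ) : seqShift^[n] s k = s (k + n) := by
  induction n generalizing s with
  | zero => rfl
  | succ n ih => rw [Function.iterate_succ_apply, ih, seqShift, add_assoc]

theorem randomIteration_eq_cocycle {Ω M : Type*} (f : I → M → M) (ξ : ℕ → Ω → I) (x : M) (n : ℕ)
    (ω : Ω) : randomIteration f ξ x n ω =
      cocycle seqShift (fun s : ℕ → I => f (s 0)) n (fun k => ξ k ω) x := by
  induction n with
  | zero => rfl
  | succ n ih => rw [cocycle_succ_apply, iterate_seqShift_apply, zero_add, ← ih, randomIteration]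

end Shift

theorem mainTheorem2 {Ω I M : Type*}
    [MeasurableSpace Ω] (P : Measure Ω) [IsProbabilityMeasure P]
    [MeasurableSpace I] (ν : Measure I) [IsProbabilityMeasure ν]
    [MetricSpace M] [TopologicalSpace.SeparableSpace M]
    (hM : ∀ K : Set M, IsClosed K → Bornology.IsBounded K → IsCompact K)
    [MeasurableSpace M] [BorelSpace M]
    (f : I → M → M) (hf : ∀ i, IsParacontraction (f i))
    (hf_meas : ∀ x, Measurable (fun i => f i x))
    (ξ : ℕ → Ω → I) (hξ : IsErgodicStationary ξ P) (hξν : ∀ n, P.map (ξ n) = ν)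
    (hC : (commonFixedPoints ν f).Nonempty) (x₀ : M) :
    ∃ X : Ω → M, Measurable X ∧ (∀ ω, X ω ∈ commonFixedPoints ν f) ∧
      ∀ᵐ ω ∂P, Tendsto (fun n => randomIteration f ξ x₀ n ω) atTop (𝓝 (X ω)) := by
  have : ProperSpace M :=
    ⟨fun _ _ => hM _ Metric.isClosed_closedBall Metric.isBounded_closedBall⟩
  have hΞ : MeasurePreserving (fun ω n => ξ n ω) P (P.map fun ω n => ξ n ω) :=
    (measurable_pi_lambda _ hξ.measurable).measurePreserving P
  have hΞ₀ : MeasurePreserving (fun s : ℕ → I => s 0) (P.map fun ω n => ξ n ω) ν :=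
    .map_of_comp ⟨hξ.measurable 0, hξν 0⟩ (measurable_pi_apply 0) hΞ.measurable
  rw [← commonFixedPoints_comp hΞ₀ hf_meas] at hC ⊢
  obtain ⟨X, hX, hXC, hlim⟩ := exists_measurable_ae_tendsto_cocycle hξ.ergodic
    (fun s => hf (s 0)) (fun x => (hf_meas x).comp (measurable_pi_apply 0)) hC x₀
  refine ⟨fun ω => X fun n => ξ n ω, hX.comp hΞ.measurable, fun ω => hXC _, ?_⟩
  simp only [randomIteration_eq_cocycle]
  exact hΞ.quasiMeasurePreserving.ae hlim
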